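/- **Theorem (strong law of large numbers).** Let $\mathcal S\subseteq[0,\infty)$ be unbounded, let $(\Omega,\mathcal F,\mathbb P)$ be a probability space with a filtration $(\mathcal F_t)_{t\ge 0}$ ($t\in\mathbb Z^+=\{0,1,2,\dots\}$), and let $X=(X_t)_{t\ge0}$ be an $(\mathcal F_t)$-adapted, $\mathcal S$-valued process (not necessarily Markov) such that * for some $x_0\in\mathcal S$, $\mathbb P[X_0\le x_0\mid\mathcal F_0]=1$ almost surely; * $\limsup_{t\to\infty}X_t=\infty$ almost surely. Let $\beta\in[0,1)$ and suppose that for some $\gamma>2+2\beta$ and some $B<\infty$, $$\sup_{t\ge0}\mathbb E\big[|X_{t+1}-X_t|^{\gamma}\,\big|\,\mathcal F_t\big]\le B\quad\text{a.s.}$$ For each $t$ let $D_t=\mathbb E[X_{t+1}-X_t\mid\mathcal F_t]$, and let $\kappa_t(x,\cdot)$ be any regular conditional distribution of $D_t$ given $X_t=x$. Define, for $x\in\mathcal S$, the upper and lower drift functions, with values in $[-\infty,\infty]$, $$\overline\mu_1(x)=\sup_{t\ge0}\ \operatorname{ess\,sup}\,\kappa_t(x,\cdot),\qquad \underline\mu_1(x)=\inf_{t\ge0}\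 \operatorname{ess\,inf}\,\kappa_t(x,\cdot),$$ where $\operatorname{ess\,sup}\nu=\inf\{z:\nu((z,\infty))=0\}$ and $\operatorname{ess\,inf}\nu=\sup\{z:\nu((-\infty,z))=0\}$ for a probability measure $\nu$ on $\mathbb R$. Suppose that for some $\rho\in(0,\infty)$, $$\lim_{x\to\infty,\ x\in\mathcal S}x^{\beta}\,\overline\mu_1(x)=\lim_{x\to\infty,\ x\in\mathcal S}x^{\beta}\,\underline\mu_1(x)=\rho .$$ Then, almost surely, as $t\to\infty$, $$\frac{X_t}{t^{1/(1+\beta)}}\longrightarrow\lambda(\rho,\beta):=\big(\rho(1+\beta)\big)^{1/(1+\beta)} .$$ -/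

import Mathlib

open MeasureTheory ProbabilityTheory Filter Topology

noncomputable section

/-- The one-step conditional mean increment `D_t = E[X_{t+1} - X_t | F_t]`. -/
def meanDrift {Ω : Type*} [m0 : MeasurableSpace Ω] (P : Measure Ω) (F : Filtration ℕ m0)
    (X : ℕ → Ω → ℝ) (t : ℕ) : Ω → ℝ :=
  P[fun ω => X (t + 1) ω - X t ω | F t]

/-- `κ t x` is the conditional law of the mean increment `D_t = E[X_{t+1} - X_t | F_t]` given
`X_t = x`: for each `t`, the Markov kernel `κ t` is a regular conditional distribution of `D_t`
given `X_t`. Writing `D_t = φ_t(X_t) + ψ_t` with `φ_t(X_t) = E[X_{t+1} - X_t | X_t]` and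
`E[ψ_t | X_t] = 0`, the measure `κ t x` is the law, given `X_t = x`, of the random variable
`μ₁(t; x) = φ_t(x) + ψ_t`. -/
structure IsDriftLaw {Ω : Type*} [m0 : MeasurableSpace Ω] (P : Measure Ω) (F : Filtration ℕ m0)
    (X : ℕ → Ω → ℝ) (κ : ℕ → Kernel ℝ ℝ) : Prop where
  markov : ∀ t, IsMarkovKernel (κ t)
  condDistrib : ∀ t, HasCondDistrib (meanDrift P F X t) (X t) (κ t) P

/-- The upper drift function `x ↦ sup_t esssup μ₁(t; x)`, the essential supremum being over the
randomness that remains given `X_t = x`. It takes values in `[-∞, ∞]`, so that no junk value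
arises where the supremum is infinite. -/
def upperDrift (κ : ℕ → Kernel ℝ ℝ) (x : ℝ) : EReal :=
  ⨆ t : ℕ, essSup (fun d : ℝ => (d : EReal)) (κ t x)

/-- The lower drift function `x ↦ inf_t essinf μ₁(t; x)`. -/
def lowerDrift (κ : ℕ → Kernel ℝ ℝ) (x : ℝ) : EReal :=
  ⨅ t : ℕ, essInf (fun d : ℝ => (d : EReal)) (κ t x)

/-- The increments of `X` have conditional `γ`-th absolute moments bounded by `B`:
`sup_t E[|X_{t+1} - X_t|^γ | F_t] ≤ B` almost surely. -/
def IncrementMomentBound {Ω : Type*} [m0 : MeasurableSpace Ω] (P : Measure Ω)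
    (F : Filtration ℕ m0) (X : ℕ → Ω → ℝ) (γ B : ℝ) : Prop :=
  (∀ t, Integrable (fun ω => |X (t + 1) ω - X t ω| ^ γ) P) ∧
    ∀ᵐ ω ∂P, ∀ t, (P[fun ω' => |X (t + 1) ω' - X t ω'| ^ γ | F t]) ω ≤ B

/-- The constant `λ(a, β) = (a (1 + β))^{1/(1+β)}`. -/
def lambdaConst (a β : ℝ) : ℝ := (a * (1 + β)) ^ (1 / (1 + β))

end

/-! Put `Y_t = X_t ^ (1 + β)`. A second-order expansion gives `E[Y_{t+1} - Y_t | F_t] = (1 + β) X_t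
^ β D_t + O(X_t ^ (β - 1))`, where `D_t` is the mean increment of `X`. Since `β < 1`, this tends to
`(1 + β) ρ` along any path with `X_t → ∞`. The claim is then a strong law for `Y`, followed by
taking a root.

Transience (`IsLampertiProcess.tendsto_atTop`): `(1 + X_t)⁻¹`, truncated at a small level, is a
bounded supermartingale, so it converges; `limsup X_t = ∞` forces the limit to be zero.

Strong law (`IsLampertiProcess.tendsto_rpow_div`): the drift of `Y` is bounded above, so `E[Y_t]`
grows at most linearly. Hence the increments of `Y` have second moment `O(t ^ (2β / (1 + β)))`, with
exponent below one. Divided by `t ^ 2` these moments are summable, so martingale convergence and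
Kronecker's lemma show that `Y_t / t` and the Cesàro mean of the drifts have the same limit. -/

/-! ### Elementary inequalities for powers. -/

/-- Convexity: the graph lies above its tangent at `x`, which is Bernoulli's inequality for `y / x`.
-/
lemma rpow_one_add_sub_ge {β x y : ℝ} (hβ : 0 ≤ β) (hx : 0 ≤ x) (hy : 0 ≤ y) :
    (1 + β) * x ^ β * (y - x) ≤ y ^ (1 + β) - x ^ (1 + β) := by
  rcases hx.eq_or_lt with rfl | hx
  · rcases hβ.eq_or_lt with rfl | hβ
    · simp
    · rw [Real.zero_rpow hβ.ne', Real.zero_rpow (by positivity)]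
      have := Real.rpow_nonneg hy (1 + β)
      simpa using this
  · have h1 := one_add_mul_self_le_rpow_one_add (s := y / x - 1)
      (by have : 0 ≤ y / x := by positivity
          linarith) (p := 1 + β) (by linarith)
    rw [add_sub_cancel, Real.div_rpow hy hx.le, le_div_iff₀ (by positivity)] at h1
    have h2 : x ^ (1 + β) = x * x ^ β := by rw [Real.rpow_add hx, Real.rpow_one]
    have h3 : (1 + (1 + β) * (y / x - 1)) * (x * x ^ β)
        = x * x ^ β + (1 + β) * x ^ β * (y - x) := by
      field_simp
    rw [h2] at h1 ⊢
    linarith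

/-- Concavity of the power `β` bounds `y ^ β` by its tangent at `x`; multiply by `x * y`. The factor
`x` keeps the negative power `x ^ (β - 1)` out of the quadratic term, so `x = 0` is allowed. -/
lemma rpow_one_add_sub_le {β x y : ℝ} (hβ : 0 ≤ β) (hβ' : β ≤ 1) (hx : 0 ≤ x) (hy : 0 ≤ y) :
    x * (y ^ (1 + β) - x ^ (1 + β)) ≤
      (1 + β) * x ^ (1 + β) * (y - x) + β * x ^ β * (y - x) ^ 2 := by
  rcases hx.eq_or_lt with rfl | hx
  · rw [Real.zero_rpow (by positivity)]
    have := Real.rpow_nonneg (le_refl (0 : ℝ)) β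
    simp only [zero_mul, mul_zero, zero_add]
    positivity
  · have h1 := rpow_one_add_le_one_add_mul_self (s := y / x - 1)
      (by have : 0 ≤ y / x := by positivity
          linarith) hβ hβ'
    rw [add_sub_cancel, Real.div_rpow hy hx.le, div_le_iff₀ (by positivity)] at h1
    have h2 : x ^ (1 + β) = x * x ^ β := by rw [Real.rpow_add hx, Real.rpow_one]
    have h2' : y ^ (1 + β) = y * y ^ β := by
      rw [Real.rpow_add' hy (by positivity), Real.rpow_one]
    have h3 := mul_le_mul_of_nonneg_left h1 (by positivity : 0 ≤ x * y)
    have h4 : x * y * ((1 + β * (y / x - 1)) * x ^ β)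
        = y * x ^ β * (x + β * (y - x)) := by
      field_simp
    rw [h4] at h3
    rw [h2, h2']
    nlinarith [h3]

/-- The tangent inequalities at both endpoints, with `y ^ β ≤ x ^ β + |y - x| ^ β` by subadditivity.
-/
lemma abs_rpow_one_add_sub_le {β x y : ℝ} (hβ : 0 ≤ β) (hβ' : β ≤ 1) (hx : 0 ≤ x) (hy : 0 ≤ y) :
    |y ^ (1 + β) - x ^ (1 + β)| ≤ 2 * x ^ β * |y - x| + 2 * |y - x| ^ (1 + β) := by
  have h1 := rpow_one_add_sub_ge hβ hx hy
  have h2 := rpow_one_add_sub_ge hβ hy hx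
  have hxb := Real.rpow_nonneg hx β
  have hyb := Real.rpow_nonneg hy β
  have hd : |y - x| ^ (1 + β) = |y - x| * |y - x| ^ β := by
    rw [Real.rpow_add' (abs_nonneg _) (by positivity), Real.rpow_one]
  have h3 : y ^ β ≤ x ^ β + |y - x| ^ β :=
    (Real.rpow_le_rpow hy (by linarith [le_abs_self (y - x)]) hβ).trans
      (Real.rpow_add_le_add_rpow hx (abs_nonneg _) hβ hβ')
  rw [hd]
  have hdb := Real.rpow_nonneg (abs_nonneg (y - x)) β
  rcases le_total x y with h | h
  · have h0 : 0 ≤ y - x := by linarith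
    rw [abs_of_nonneg h0] at *
    have : y ^ (1 + β) - x ^ (1 + β) ≤ 2 * (x ^ β + (y - x) ^ β) * (y - x) := by
      have : (1 + β) * y ^ β * (y - x) ≤ 2 * (x ^ β + (y - x) ^ β) * (y - x) := by gcongr; linarith
      linarith
    rw [abs_le]
    constructor
    · have : 0 ≤ (1 + β) * x ^ β * (y - x) := by positivity
      have : 0 ≤ (x ^ β + (y - x) ^ β) * (y - x) := by positivity
      nlinarith
    · linarith
  · have h0 : 0 ≤ x - y := by linarith
    rw [abs_sub_comm y x, abs_of_nonneg h0] at *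
    have : (1 + β) * x ^ β * (x - y) ≤ 2 * x ^ β * (x - y) := by gcongr; linarith
    have h4 : 0 ≤ (x - y) * (x - y) ^ β := by positivity
    rw [abs_le]
    constructor
    · linarith
    · have : 0 ≤ (1 + β) * y ^ β * (x - y) := by positivity
      have : 0 ≤ 2 * x ^ β * (x - y) := by positivity
      linarith

lemma rpow_le_one_add_rpow {a p q : ℝ} (ha : 0 ≤ a) (hp : 0 ≤ p) (hpq : p ≤ q) :
    a ^ p ≤ 1 + a ^ q := by
  have := Real.rpow_nonneg ha q
  rcases le_total a 1 with h | h
  · linarith [Real.rpow_le_one ha h hp]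
  · linarith [Real.rpow_le_rpow_of_exponent_le h hpq]

lemma rpow_mul_rpow_le {x y a b q : ℝ} (hx : 0 ≤ x) (hy : 0 ≤ y) (ha : 0 ≤ a) (hb : 0 ≤ b)
    (hab : a + b ≤ q) : x ^ a * y ^ b ≤ 1 + x ^ q + y ^ q := by
  have hm : 0 ≤ max x y := hx.trans (le_max_left _ _)
  have h1 : x ^ a * y ^ b ≤ max x y ^ a * max x y ^ b := by
    gcongr
    · exact le_max_left _ _
    · exact le_max_right _ _
  rw [← Real.rpow_add_of_nonneg hm ha hb] at h1
  have h2 := rpow_le_one_add_rpow hm (by positivity) hab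
  have := Real.rpow_nonneg hx q
  have := Real.rpow_nonneg hy q
  rcases max_cases x y with ⟨h, -⟩ | ⟨h, -⟩ <;> rw [h] at h1 h2 <;> linarith

/-- One-step estimate for the Lyapunov function `(1 + x)⁻¹`: a first-order expansion whose error has
order `(1 + x) ^ (-q)`. The right side is affine in `y - x` and `|y - x| ^ γ`, ready for
conditioning. -/
lemma inv_one_add_le {x y γ q : ℝ} (hγ : 2 ≤ γ) (hqγ : q ≤ γ) (hq3 : q ≤ 3)
    (hx : 0 ≤ x) (hy : 0 ≤ y) :
    (1 + y)⁻¹ ≤ ((1 + x)⁻¹ + (2 + 2 ^ γ) * (1 + x) ^ (-q)) + (-(1 + x) ^ (-2 : ℝ)) * (y - x)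
      + (2 + 2 ^ γ) * (1 + x) ^ (-q) * |y - x| ^ γ := by
  set a := 1 + x with ha
  have ha1 : 1 ≤ a := by linarith
  have ha0 : 0 < a := by linarith
  set d := y - x with hd
  have had : 1 + y = a + d := by rw [ha, hd]; ring
  have hpos : 0 < a + d := by rw [← had]; linarith
  have e2 : a ^ (-2 : ℝ) = (a ^ 2)⁻¹ := by
    rw [Real.rpow_neg ha0.le]; norm_num
  have h2g : (0 : ℝ) ≤ 2 ^ γ := by positivity
  have hdg : 0 ≤ |d| ^ γ := by positivity
  have haq : 0 < a ^ (-q) := by positivity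
  have key : (a + d)⁻¹ = a⁻¹ - (a ^ 2)⁻¹ * d + d ^ 2 * ((a ^ 2)⁻¹ * (a + d)⁻¹) := by
    field_simp
    ring
  have main : d ^ 2 * ((a ^ 2)⁻¹ * (a + d)⁻¹) ≤ (2 + 2 ^ γ) * a ^ (-q) * (1 + |d| ^ γ) := by
    -- Without a large downward jump the remainder is at most `2 d ^ 2 / a ^ 3`, whence `q ≤ 3`.
    -- Otherwise `a ≤ 2 |d|`, and powers of `a` are traded for powers of `|d|`, whence `q ≤ γ`.
    rcases le_or_gt (-(a / 2)) d with h | h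
    · have h1 : (a + d)⁻¹ ≤ 2 * a⁻¹ := by
        rw [show 2 * a⁻¹ = (a / 2)⁻¹ by field_simp]
        exact inv_anti₀ (by positivity) (by linarith)
      have h3 : (a ^ 2)⁻¹ * a⁻¹ ≤ a ^ (-q) := by
        have : (a ^ 2)⁻¹ * a⁻¹ = a ^ (-3 : ℝ) := by
          rw [Real.rpow_neg ha0.le, ← mul_inv, ← pow_succ]; norm_num
        rw [this]
        exact Real.rpow_le_rpow_of_exponent_le ha1 (by linarith)
      have h4 : d ^ 2 ≤ 1 + |d| ^ γ := by
        have := rpow_le_one_add_rpow (abs_nonneg d) (by norm_num : (0:ℝ) ≤ 2) hγ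
        simpa using this
      calc d ^ 2 * ((a ^ 2)⁻¹ * (a + d)⁻¹) ≤ d ^ 2 * ((a ^ 2)⁻¹ * (2 * a⁻¹)) := by gcongr
        _ = 2 * (((a ^ 2)⁻¹ * a⁻¹) * d ^ 2) := by ring
        _ ≤ 2 * (a ^ (-q) * (1 + |d| ^ γ)) := by gcongr
        _ ≤ (2 + 2 ^ γ) * (a ^ (-q) * (1 + |d| ^ γ)) := by gcongr; linarith
        _ = _ := by ring
    · have hdabs : a ≤ 2 * |d| := by
        rw [abs_of_neg (by linarith)]; linarith
      have h1 : (a + d)⁻¹ ≤ 1 := inv_le_one_of_one_le₀ (by rw [← had]; linarith)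
      have h2 : a ^ (γ - 2) ≤ (2 * |d|) ^ (γ - 2) := by gcongr
      have h3 : (a ^ 2)⁻¹ = a ^ (-γ) * a ^ (γ - 2) := by
        rw [← e2, ← Real.rpow_add ha0]; congr 1; ring
      have h5 : a ^ (-γ) ≤ a ^ (-q) := Real.rpow_le_rpow_of_exponent_le ha1 (by linarith)
      have h6 : (2 * |d|) ^ (γ - 2) * (2 * |d|) ^ (2 : ℝ) = 2 ^ γ * |d| ^ γ := by
        rw [← Real.rpow_add (by linarith), sub_add_cancel, Real.mul_rpow (by norm_num) (abs_nonneg _)]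
      have h7 : d ^ 2 ≤ (2 * |d|) ^ (2 : ℝ) := by
        rw [Real.rpow_two, mul_pow, sq_abs]; linarith [sq_nonneg d]
      calc d ^ 2 * ((a ^ 2)⁻¹ * (a + d)⁻¹) ≤ d ^ 2 * ((a ^ 2)⁻¹ * 1) := by gcongr
        _ = a ^ (-γ) * (a ^ (γ - 2) * d ^ 2) := by rw [h3]; ring
        _ ≤ a ^ (-q) * ((2 * |d|) ^ (γ - 2) * (2 * |d|) ^ (2 : ℝ)) := by gcongr
        _ = a ^ (-q) * (2 ^ γ * |d| ^ γ) := by rw [h6]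
        _ ≤ a ^ (-q) * ((2 + 2 ^ γ) * (1 + |d| ^ γ)) := by
            gcongr
            · linarith
            · linarith
        _ = _ := by ring
  rw [had, key, e2]
  linarith

/-! ### Strong law for martingale differences. -/

/-- The weighted form of Kronecker's lemma with weights `s + 1`. -/
lemma tendsto_average_zero_of_tendsto_sum_div {ξ : ℕ → ℝ} {l : ℝ}
    (h : Tendsto (fun t : ℕ => ∑ s ∈ Finset.range t, ξ s / ((s : ℝ) + 1)) atTop (𝓝 l)) :
    Tendsto (fun t : ℕ => (t : ℝ)⁻¹ * ∑ s ∈ Finset.range t, ξ s) atTop (𝓝 0) := by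
  set N : ℕ → ℝ := fun t => ∑ s ∈ Finset.range t, ξ s / ((s : ℝ) + 1) with hN
  -- Summation by parts: the average of `ξ` becomes `N t` minus the Cesàro mean of `N`, and both
  -- tend to `l`.
  have key : ∀ t : ℕ, ∑ s ∈ Finset.range t, ξ s = t * N t - ∑ s ∈ Finset.range t, N s := by
    intro t
    induction t with
    | zero => simp
    | succ n ih =>
      have : N (n + 1) = N n + ξ n / ((n : ℝ) + 1) := by simp [hN, Finset.sum_range_succ]
      have hn : (n : ℝ) + 1 ≠ 0 := by positivity
      rw [Finset.sum_range_succ, ih, Finset.sum_range_succ, this]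
      push_cast
      field_simp
      ring
  have h2 := h.sub h.cesaro
  rw [sub_self] at h2
  refine h2.congr' ?_
  filter_upwards [eventually_gt_atTop 0] with t ht
  have : (t : ℝ) ≠ 0 := by positivity
  rw [key]
  field_simp

lemma condExp_le_of_le_affine {Ω : Type*} {m m0 : MeasurableSpace Ω} {P : Measure Ω}
    [IsProbabilityMeasure P] (hm : m ≤ m0) {U Δ V a b c : Ω → ℝ}
    (ha : StronglyMeasurable[m] a) (hb : StronglyMeasurable[m] b) (hc : StronglyMeasurable[m] c)
    (hU : Integrable U P) (hai : Integrable a P) (hΔ : Integrable Δ P) (hV : Integrable V P)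
    (hbΔ : Integrable (fun ω => b ω * Δ ω) P) (hcV : Integrable (fun ω => c ω * V ω) P)
    (h : ∀ ω, U ω ≤ a ω + b ω * Δ ω + c ω * V ω) :
    ∀ᵐ ω ∂P, (P[U | m]) ω ≤ a ω + b ω * (P[Δ | m]) ω + c ω * (P[V | m]) ω := by
  have h1 : P[U | m] ≤ᵐ[P] P[a + b * Δ + c * V | m] :=
    condExp_mono hU ((hai.add hbΔ).add hcV) (ae_of_all _ h)
  have h2 := condExp_add (m := m) (hai.add hbΔ) hcV
  have h3 := condExp_add (m := m) hai hbΔ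
  have h4 := condExp_mul_of_stronglyMeasurable_left hb hbΔ hΔ
  have h5 := condExp_mul_of_stronglyMeasurable_left hc hcV hV
  have h6 := condExp_of_stronglyMeasurable hm ha hai
  filter_upwards [h1, h2, h3, h4, h5] with ω h1 h2 h3 h4 h5
  refine h1.trans (le_of_eq ?_)
  change (P[a + b * Δ + c * V | m]) ω = (P[a + b * Δ | m] + P[c * V | m]) ω at h2
  change (P[a + b * Δ | m]) ω = (P[a | m] + P[b * Δ | m]) ω at h3
  rw [h2, Pi.add_apply, h3, Pi.add_apply, h4, h5, h6]
  rfl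

lemma integral_sub_condExp_sq_le {Ω : Type*} {m m0 : MeasurableSpace Ω} {P : Measure Ω}
    [IsProbabilityMeasure P] (hm : m ≤ m0) {Z : Ω → ℝ} (hZ : MemLp Z 2 P) :
    ∫ ω, (Z ω - (P[Z | m]) ω) ^ 2 ∂P ≤ ∫ ω, Z ω ^ 2 ∂P := by
  have h1 : ∫ ω, (Var[Z; P | m]) ω ∂P = ∫ ω, (Z ω - (P[Z | m]) ω) ^ 2 ∂P := integral_condExp hm
  have h2 : ∫ ω, (P[Z ^ 2 | m]) ω ∂P = ∫ ω, Z ω ^ 2 ∂P := integral_condExp hm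
  rw [← h1, ← h2]
  exact integral_mono_ae integrable_condVar integrable_condExp (condVar_ae_le_condExp_sq hm hZ)

/-- An `L²`-bounded series of martingale differences converges almost surely. -/
lemma ae_tendsto_sum_martingale_diff {Ω : Type*} [m0 : MeasurableSpace Ω] {P : Measure Ω}
    [IsProbabilityMeasure P] {F : Filtration ℕ m0} {ξ : ℕ → Ω → ℝ}
    (hξm : ∀ t, StronglyMeasurable[F (t + 1)] (ξ t)) (hξ : ∀ t, MemLp (ξ t) 2 P)
    (hξ0 : ∀ t, P[ξ t | F t] =ᵐ[P] 0) (hsum : Summable fun t => ∫ ω, ξ t ω ^ 2 ∂P) :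
    ∀ᵐ ω ∂P, ∃ l, Tendsto (fun t => ∑ s ∈ Finset.range t, ξ s ω) atTop (𝓝 l) := by
  set N : ℕ → Ω → ℝ := fun t ω => ∑ s ∈ Finset.range t, ξ s ω with hN
  have hNs : ∀ t, N (t + 1) = N t + ξ t := fun t => by
    ext ω; simp [hN, Finset.sum_range_succ]
  have hNm : StronglyAdapted F N := by
    intro t
    refine Finset.stronglyMeasurable_fun_sum _ fun s hs => (hξm s).mono (F.mono ?_)
    exact Finset.mem_range.1 hs
  have hN2 : ∀ t, MemLp (N t) 2 P := fun t => memLp_finsetSum _ fun s _ => hξ s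
  have hmart : Martingale N F P := by
    refine martingale_of_condExp_sub_eq_zero_nat hNm
      (fun t => (hN2 t).integrable one_le_two) fun t => ?_
    rw [hNs, add_sub_cancel_left]
    exact hξ0 t
  -- Each increment is orthogonal to the past, so second moments add up.
  have hcross : ∀ t, ∫ ω, N t ω * ξ t ω ∂P = 0 := by
    intro t
    have hi : Integrable (N t * ξ t) P := (hN2 t).integrable_mul (hξ t)
    have h1 := condExp_mul_of_stronglyMeasurable_left (hNm t) hi ((hξ t).integrable one_le_two)
    have h2 : ∫ ω, (P[N t * ξ t | F t]) ω ∂P = ∫ ω, (N t * ξ t) ω ∂P := integral_condExp (F.le t)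
    change ∫ ω, (N t * ξ t) ω ∂P = 0
    rw [← h2, ← integral_zero Ω ℝ (μ := P)]
    refine integral_congr_ae ?_
    filter_upwards [h1, hξ0 t] with ω h1 h2
    rw [h1, Pi.mul_apply, h2, Pi.zero_apply, mul_zero]
  have hsq : ∀ t, ∫ ω, N t ω ^ 2 ∂P = ∑ s ∈ Finset.range t, ∫ ω, ξ s ω ^ 2 ∂P := by
    intro t
    induction t with
    | zero => simp [hN]
    | succ t ih =>
      have hi : Integrable (fun ω => N t ω * ξ t ω) P := (hN2 t).integrable_mul (hξ t)
      have hi' : Integrable (fun ω => N t ω ^ 2 + 2 * (N t ω * ξ t ω)) P :=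
        (hN2 t).integrable_sq.add (hi.const_mul 2)
      have : ∀ ω, N (t + 1) ω ^ 2 = N t ω ^ 2 + 2 * (N t ω * ξ t ω) + ξ t ω ^ 2 := fun ω => by
        rw [hNs, Pi.add_apply]; ring
      simp_rw [this]
      rw [integral_add hi' (hξ t).integrable_sq,
        integral_add (hN2 t).integrable_sq (hi.const_mul 2), integral_const_mul, hcross,
        Finset.sum_range_succ, ih]
      ring
  refine hmart.submartingale.exists_ae_tendsto_of_bdd
    (R := (1 + ∑' t, ∫ ω, ξ t ω ^ 2 ∂P).toNNReal) fun t => ?_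
  -- The convergence theorem asks for an `L¹` bound, which `|n| ≤ 1 + n ^ 2` supplies.
  have hb : ∫ ω, |N t ω| ∂P ≤ 1 + ∑' t, ∫ ω, ξ t ω ^ 2 ∂P := by
    calc ∫ ω, |N t ω| ∂P ≤ ∫ ω, (1 + N t ω ^ 2) ∂P := by
          refine integral_mono ((hN2 t).integrable one_le_two).abs
            ((integrable_const _).add (hN2 t).integrable_sq) fun ω => ?_
          simp only
          nlinarith [sq_abs (N t ω), sq_nonneg (|N t ω| - 1), sq_nonneg (N t ω)]
      _ = 1 + ∑ s ∈ Finset.range t, ∫ ω, ξ s ω ^ 2 ∂P := by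
          rw [integral_add (integrable_const _) (hN2 t).integrable_sq, hsq]; simp
      _ ≤ _ := by
          gcongr
          exact hsum.sum_le_tsum _ fun s _ => integral_nonneg fun ω => sq_nonneg _
  rw [eLpNorm_one_eq_lintegral_enorm,
    ← ofReal_integral_norm_eq_lintegral_enorm ((hN2 t).integrable one_le_two)]
  exact ENNReal.ofReal_le_ofReal hb

/-- A strong law of large numbers for conditionally centred square integrable variables. -/
lemma ae_tendsto_average_sub_condExp {Ω : Type*} [m0 : MeasurableSpace Ω] {P : Measure Ω}
    [IsProbabilityMeasure P] {F : Filtration ℕ m0} {Z : ℕ → Ω → ℝ}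
    (hZm : ∀ t, StronglyMeasurable[F (t + 1)] (Z t)) (hZ : ∀ t, MemLp (Z t) 2 P)
    (hsum : Summable fun t : ℕ => (∫ ω, Z t ω ^ 2 ∂P) / ((t : ℝ) + 1) ^ 2) :
    ∀ᵐ ω ∂P, Tendsto (fun t : ℕ => (t : ℝ)⁻¹ *
      ∑ s ∈ Finset.range t, (Z s ω - (P[Z s | F s]) ω)) atTop (𝓝 0) := by
  have hc : ∀ t, MemLp (fun ω => Z t ω - (P[Z t | F t]) ω) 2 P := fun t =>
    (hZ t).sub ((hZ t).condExp one_le_two)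
  have hconv := ae_tendsto_sum_martingale_diff (P := P) (F := F)
    (ξ := fun t ω => ((t : ℝ) + 1)⁻¹ * (Z t ω - (P[Z t | F t]) ω)) ?_ ?_ ?_ ?_
  · filter_upwards [hconv] with ω ⟨l, hl⟩
    refine tendsto_average_zero_of_tendsto_sum_div (l := l) ?_
    simpa only [div_eq_inv_mul] using hl
  · intro t
    exact (((hZm t).sub (stronglyMeasurable_condExp.mono (F.mono (Nat.le_succ t)))).const_mul _)
  · exact fun t => (hc t).const_mul _
  · intro t
    have h0 := condExp_smul (μ := P) ((t : ℝ) + 1)⁻¹ (Z t - P[Z t | F t]) (F t)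
    have hZi := (hZ t).integrable one_le_two
    have h1 := condExp_sub (m := F t) hZi (integrable_condExp (f := Z t) (m := F t) (μ := P))
    have h2 := condExp_of_stronglyMeasurable (μ := P) (F.le t)
      (stronglyMeasurable_condExp (f := Z t) (μ := P)) integrable_condExp
    filter_upwards [h0, h1] with ω h0 h1
    change (P[((t : ℝ) + 1)⁻¹ • (Z t - P[Z t | F t]) | F t]) ω = 0
    rw [h0, Pi.smul_apply, h1, Pi.sub_apply, h2]
    simp
  · refine hsum.of_nonneg_of_le (fun t => integral_nonneg fun ω => sq_nonneg _) fun t => ?_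
    simp_rw [mul_pow]
    rw [integral_const_mul, inv_pow, ← div_eq_inv_mul]
    exact div_le_div_of_nonneg_right (integral_sub_condExp_sq_le (F.le t) (hZ t)) (by positivity)

/-! ### From the conditional drift laws to almost sure drift bounds. -/

/-- The joint law of `(X, Y)` is the law of `X` composed with `κ`, so a set that is full in every
fibre is full. -/
lemma HasCondDistrib.ae_of_kernel {Ω : Type*} [MeasurableSpace Ω] {P : Measure Ω}
    [IsProbabilityMeasure P] {X Y : Ω → ℝ} {κ : Kernel ℝ ℝ} [IsMarkovKernel κ]
    (h : HasCondDistrib Y X κ P) {A : Set (ℝ × ℝ)} (hA : MeasurableSet A)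
    (hκ : ∀ ω, ∀ᵐ d ∂κ (X ω), (X ω, d) ∈ A) : ∀ᵐ ω ∂P, (X ω, Y ω) ∈ A := by
  have hmap : P.map (fun ω => (X ω, Y ω)) = (P.map X) ⊗ₘ κ := h.map_eq
  have : IsProbabilityMeasure (P.map X) := Measure.isProbabilityMeasure_map h.aemeasurable_fst
  have h1 : ∀ᵐ z ∂(P.map fun ω => (X ω, Y ω)), z ∈ A := by
    rw [hmap, Measure.ae_compProd_iff (p := fun z => z ∈ A) hA,
      ae_map_iff h.aemeasurable_fst ?_]
    · exact ae_of_all _ hκ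
    · exact Kernel.measurable_kernel_prodMk_left hA.compl (measurableSet_singleton 0)
  exact ae_of_ae_map (h.aemeasurable_fst.prodMk h.aemeasurable_snd) h1

lemma eventually_rpow_mul_drift_mem_Icc {Ω : Type*} [m0 : MeasurableSpace Ω] {P : Measure Ω}
    [IsProbabilityMeasure P] {F : Filtration ℕ m0} {S : Set ℝ} {X : ℕ → Ω → ℝ}
    (hX_mem : ∀ t ω, X t ω ∈ S) {β : ℝ} {κ : ℕ → Kernel ℝ ℝ} (hκ : IsDriftLaw P F X κ) {ρ : ℝ}
    (hupper : Tendsto (fun x : ℝ => ((x ^ β : ℝ) : EReal) * upperDrift κ x)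
      (atTop ⊓ 𝓟 S) (𝓝 (ρ : EReal)))
    (hlower : Tendsto (fun x : ℝ => ((x ^ β : ℝ) : EReal) * lowerDrift κ x)
      (atTop ⊓ 𝓟 S) (𝓝 (ρ : EReal))) {ε : ℝ} (hε : 0 < ε) :
    ∃ x₁ : ℝ, 1 ≤ x₁ ∧ ∀ᵐ ω ∂P, ∀ t, x₁ ≤ X t ω →
      X t ω ^ β * meanDrift P F X t ω ∈ Set.Icc (ρ - ε) (ρ + ε) := by
  have h1 := (hupper.eventually_lt_const (u := ((ρ + ε : ℝ) : EReal))
    (by exact_mod_cast (by linarith : ρ < ρ + ε))).and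
    (hlower.eventually_const_lt (u := ((ρ - ε : ℝ) : EReal))
    (by exact_mod_cast (by linarith : ρ - ε < ρ)))
  rw [eventually_inf_principal, eventually_atTop] at h1
  obtain ⟨x₁, hx₁⟩ := h1
  refine ⟨max x₁ 1, le_max_right _ _, ae_all_iff.2 fun t => ?_⟩
  have := hκ.markov t
  have hA : MeasurableSet {z : ℝ × ℝ | max x₁ 1 ≤ z.1 → z.1 ^ β * z.2 ∈ Set.Icc (ρ - ε) (ρ + ε)} := by
    have e : {z : ℝ × ℝ | max x₁ 1 ≤ z.1 → z.1 ^ β * z.2 ∈ Set.Icc (ρ - ε) (ρ + ε)}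
        = {z : ℝ × ℝ | max x₁ 1 ≤ z.1}ᶜ ∪
          (fun z : ℝ × ℝ => z.1 ^ β * z.2) ⁻¹' Set.Icc (ρ - ε) (ρ + ε) := by
      ext z; simp [imp_iff_not_or]
    rw [e]
    exact (measurableSet_le measurable_const measurable_fst).compl.union
      (((measurable_fst.pow_const β).mul measurable_snd) measurableSet_Icc)
  refine HasCondDistrib.ae_of_kernel (hκ.condDistrib t) hA fun ω => ?_
  have hup : ∀ᵐ d : ℝ ∂κ t (X t ω), (d : EReal) ≤ upperDrift κ (X t ω) := by
    filter_upwards [ae_le_essSup (μ := κ t (X t ω)) (f := fun d : ℝ => (d : EReal))] with d hd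
    refine hd.trans ?_
    unfold upperDrift
    exact le_iSup_of_le t le_rfl
  have hlo : ∀ᵐ d : ℝ ∂κ t (X t ω), lowerDrift κ (X t ω) ≤ (d : EReal) := by
    filter_upwards [ae_essInf_le (μ := κ t (X t ω)) (f := fun d : ℝ => (d : EReal))] with d hd
    refine le_trans ?_ hd
    unfold lowerDrift
    exact iInf_le_of_le t le_rfl
  filter_upwards [hup, hlo] with d hd hd' hx
  obtain ⟨h2, h3⟩ := hx₁ _ ((le_max_left _ _).trans hx) (hX_mem t ω)
  -- Multiplication in `EReal` preserves order only for a nonnegative factor; the threshold `max x₁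
  -- 1` guarantees this.
  have hnn : (0 : EReal) ≤ ((X t ω ^ β : ℝ) : EReal) := by
    have : 1 ≤ X t ω := (le_max_right _ _).trans hx
    exact_mod_cast Real.rpow_nonneg (by linarith) β
  constructor
  · have := (h3.trans_le (mul_le_mul_of_nonneg_left hd' hnn)).le
    exact_mod_cast this
  · have := ((mul_le_mul_of_nonneg_left hd hnn).trans_lt h2).le
    exact_mod_cast this

lemma integrable_rpow_mul_rpow {Ω : Type*} [MeasurableSpace Ω] {P : Measure Ω}
    [IsProbabilityMeasure P] {f g : Ω → ℝ} {γ a b : ℝ} (hfm : Measurable f) (hgm : Measurable g)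
    (hf0 : ∀ ω, 0 ≤ f ω) (hg0 : ∀ ω, 0 ≤ g ω) (hf : Integrable (fun ω => f ω ^ γ) P)
    (hg : Integrable (fun ω => g ω ^ γ) P) (ha : 0 ≤ a) (hb : 0 ≤ b) (hab : a + b ≤ γ) :
    Integrable (fun ω => f ω ^ a * g ω ^ b) P := by
  refine Integrable.mono' (((integrable_const (1 : ℝ)).add hf).add hg)
    ((hfm.pow_const a).mul (hgm.pow_const b)).aestronglyMeasurable (ae_of_all _ fun ω => ?_)
  have := Real.rpow_nonneg (hf0 ω) a
  have := Real.rpow_nonneg (hg0 ω) b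
  rw [Real.norm_of_nonneg (by positivity)]
  exact rpow_mul_rpow_le (hf0 ω) (hg0 ω) ha hb hab

/-! ### Moments and transience. -/

/-- A nonnegative adapted process with bounded initial value and increments whose conditional
moments of order `γ ≥ 2` are bounded. -/
structure IsLampertiProcess {Ω : Type*} [m0 : MeasurableSpace Ω] (P : Measure Ω)
    (F : Filtration ℕ m0) (X : ℕ → Ω → ℝ) (γ B : ℝ) : Prop where
  adapted : Adapted F X
  nonneg : ∀ t ω, 0 ≤ X t ω
  init : ∃ x₀, ∀ᵐ ω ∂P, X 0 ω ≤ x₀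
  two_le : 2 ≤ γ
  moment : IncrementMomentBound P F X γ B

namespace IsLampertiProcess

variable {Ω : Type*} [m0 : MeasurableSpace Ω] {P : Measure Ω} {F : Filtration ℕ m0}
  {X : ℕ → Ω → ℝ} {γ B : ℝ}

lemma stronglyMeasurable (h : IsLampertiProcess P F X γ B) (t : ℕ) :
    StronglyMeasurable[F t] (X t) :=
  (h.adapted t).stronglyMeasurable

lemma stronglyMeasurable_rpow (h : IsLampertiProcess P F X γ B) (t : ℕ) (e : ℝ) :
    StronglyMeasurable[F t] fun ω => X t ω ^ e :=
  Measurable.stronglyMeasurable ((h.adapted t).pow_const e)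

lemma measurable (h : IsLampertiProcess P F X γ B) (t : ℕ) : Measurable (X t) :=
  (h.adapted t).mono (F.le t) le_rfl

lemma measurable_abs_increment (h : IsLampertiProcess P F X γ B) (t : ℕ) :
    Measurable fun ω => |X (t + 1) ω - X t ω| :=
  continuous_abs.measurable.comp ((h.measurable (t + 1)).sub (h.measurable t))

variable [IsProbabilityMeasure P]

lemma bound_nonneg (h : IsLampertiProcess P F X γ B) : 0 ≤ B := by
  have h1 : ∀ᵐ ω ∂P, 0 ≤ (P[fun ω' => |X (0 + 1) ω' - X 0 ω'| ^ γ | F 0]) ω :=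
    condExp_nonneg (ae_of_all _ fun ω => by simp only [Pi.zero_apply]; positivity)
  obtain ⟨ω, h2, h3⟩ := (h1.and h.moment.2).exists
  exact h2.trans (h3 0)

lemma integrable_rpow (h : IsLampertiProcess P F X γ B) (t : ℕ) :
    Integrable (fun ω => X t ω ^ γ) P := by
  have hγ : 0 ≤ γ := by linarith [h.two_le]
  induction t with
  | zero =>
    obtain ⟨x₀, hx₀⟩ := h.init
    refine Integrable.mono' (integrable_const (x₀ ^ γ))
      ((h.measurable 0).pow_const γ).aestronglyMeasurable ?_
    filter_upwards [hx₀] with ω hω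
    rw [Real.norm_of_nonneg (Real.rpow_nonneg (h.nonneg 0 ω) _)]
    exact Real.rpow_le_rpow (h.nonneg 0 ω) hω hγ
  | succ t ih =>
    refine Integrable.mono' ((ih.add (h.moment.1 t)).const_mul (2 ^ γ))
      ((h.measurable (t + 1)).pow_const γ).aestronglyMeasurable (ae_of_all _ fun ω => ?_)
    have h0 := h.nonneg t ω
    have h1 := h.nonneg (t + 1) ω
    rw [Real.norm_of_nonneg (Real.rpow_nonneg h1 _), Pi.add_apply]
    have hXg := Real.rpow_nonneg h0 γ
    have hdg := Real.rpow_nonneg (abs_nonneg (X (t + 1) ω - X t ω)) γ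
    have hle := le_abs_self (X (t + 1) ω - X t ω)
    -- `X (t + 1)` is at most twice the larger of `X t` and the absolute increment.
    rcases le_total (X t ω) |X (t + 1) ω - X t ω| with hc | hc
    · calc X (t + 1) ω ^ γ ≤ (2 * |X (t + 1) ω - X t ω|) ^ γ :=
            Real.rpow_le_rpow h1 (by linarith) hγ
        _ = 2 ^ γ * |X (t + 1) ω - X t ω| ^ γ := Real.mul_rpow (by norm_num) (abs_nonneg _)
        _ ≤ _ := by gcongr; linarith
    · calc X (t + 1) ω ^ γ ≤ (2 * X t ω) ^ γ := Real.rpow_le_rpow h1 (by linarith) hγ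
        _ = 2 ^ γ * X t ω ^ γ := Real.mul_rpow (by norm_num) h0
        _ ≤ _ := by gcongr; linarith

lemma integrable_mul_increment (h : IsLampertiProcess P F X γ B) (t : ℕ) {a b : ℝ} (ha : 0 ≤ a)
    (hb : 0 ≤ b) (hab : a + b ≤ γ) :
    Integrable (fun ω => X t ω ^ a * |X (t + 1) ω - X t ω| ^ b) P :=
  integrable_rpow_mul_rpow (h.measurable t) (h.measurable_abs_increment t) (h.nonneg t)
    (fun _ => abs_nonneg _) (h.integrable_rpow t) (h.moment.1 t) ha hb hab

lemma integrable_mul_succ (h : IsLampertiProcess P F X γ B) (t : ℕ) {a b : ℝ} (ha : 0 ≤ a)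
    (hb : 0 ≤ b) (hab : a + b ≤ γ) :
    Integrable (fun ω => X t ω ^ a * X (t + 1) ω ^ b) P :=
  integrable_rpow_mul_rpow (h.measurable t) (h.measurable (t + 1)) (h.nonneg t)
    (h.nonneg (t + 1)) (h.integrable_rpow t) (h.integrable_rpow (t + 1)) ha hb hab

lemma integrable_rpow_le (h : IsLampertiProcess P F X γ B) (t : ℕ) {a : ℝ} (ha : 0 ≤ a)
    (haγ : a ≤ γ) : Integrable (fun ω => X t ω ^ a) P := by
  simpa using h.integrable_mul_succ t ha le_rfl (by simpa using haγ)

lemma integrable_rpow_mul_drift (h : IsLampertiProcess P F X γ B) (t : ℕ) {a : ℝ} (ha : 0 ≤ a)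
    (haγ : a + 1 ≤ γ) : Integrable (fun ω => X t ω ^ a * (X (t + 1) ω - X t ω)) P := by
  refine (h.integrable_mul_increment t ha zero_le_one haγ).mono'
    (((h.measurable t).pow_const a).mul
      ((h.measurable (t + 1)).sub (h.measurable t))).aestronglyMeasurable (ae_of_all _ fun ω => ?_)
  rw [norm_mul, Real.norm_of_nonneg (Real.rpow_nonneg (h.nonneg t ω) a), Real.rpow_one]
  rfl

lemma integrable_rpow_mul_sq (h : IsLampertiProcess P F X γ B) (t : ℕ) {a : ℝ} (ha : 0 ≤ a)
    (haγ : a + 2 ≤ γ) : Integrable (fun ω => X t ω ^ a * (X (t + 1) ω - X t ω) ^ 2) P := by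
  simpa using h.integrable_mul_increment t ha zero_le_two haγ

lemma integrable_increment (h : IsLampertiProcess P F X γ B) (t : ℕ) :
    Integrable (fun ω => X (t + 1) ω - X t ω) P := by
  simpa using h.integrable_rpow_mul_drift t le_rfl (by linarith [h.two_le])

lemma integrable_sq (h : IsLampertiProcess P F X γ B) (t : ℕ) :
    Integrable (fun ω => (X (t + 1) ω - X t ω) ^ 2) P := by
  simpa using h.integrable_rpow_mul_sq t le_rfl (by linarith [h.two_le])

lemma condExp_sq_le (h : IsLampertiProcess P F X γ B) :
    ∀ᵐ ω ∂P, ∀ t, (P[fun ω' => (X (t + 1) ω' - X t ω') ^ 2 | F t]) ω ≤ 1 + B := by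
  refine ae_all_iff.2 fun t => ?_
  have h1 := condExp_le_of_le_affine (P := P) (F.le t)
    (U := fun ω => (X (t + 1) ω - X t ω) ^ 2) (Δ := 0)
    (V := fun ω => |X (t + 1) ω - X t ω| ^ γ) (a := 1) (b := 0) (c := 1)
    stronglyMeasurable_one stronglyMeasurable_zero stronglyMeasurable_one (h.integrable_sq t)
    (integrable_const 1) (integrable_zero _ _ _) (h.moment.1 t) (by simp)
    (by simpa using h.moment.1 t) (fun ω => by
      have := rpow_le_one_add_rpow (abs_nonneg (X (t + 1) ω - X t ω)) zero_le_two h.two_le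
      simpa using this)
  filter_upwards [h1, h.moment.2] with ω h1 h2
  have := h2 t
  simp only [Pi.one_apply, Pi.zero_apply] at h1
  linarith

/-- For large `X_t`, the drift lowers `(1 + X_t)⁻¹` by at least `ρ (1 + X_t) ^ (-2 - β)`, which
beats the error `C (1 + B) (1 + X_t) ^ (-q)` because `q > 2 + β`. -/
lemma tendsto_atTop (h : IsLampertiProcess P F X γ B)
    (hX_limsup : ∀ᵐ ω ∂P, limsup (fun t => (X t ω : EReal)) atTop = ⊤)
    {β ρ x₁ : ℝ} (hβ : 0 ≤ β) (hβ' : β < 1) (hγ : 2 + β < γ) (hρ : 0 < ρ)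
    (hdrift : ∀ᵐ ω ∂P, ∀ t, x₁ ≤ X t ω → ρ ≤ X t ω ^ β * meanDrift P F X t ω) :
    ∀ᵐ ω ∂P, Tendsto (fun t => X t ω) atTop atTop := by
  set q := min γ 3 with hq
  have hq2 : 0 < q - (2 + β) := by
    rw [sub_pos]; exact lt_min hγ (by linarith)
  set C : ℝ := 2 + 2 ^ γ with hC
  have hC0 : 0 ≤ C := by positivity
  obtain ⟨x₂, hx₂⟩ : ∃ x₂, ∀ a ≥ x₂, C * (1 + B) * a ^ (-(q - (2 + β))) < ρ := by
    have h1 := (tendsto_rpow_neg_atTop hq2).const_mul (C * (1 + B))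
    rw [mul_zero] at h1
    exact eventually_atTop.1 (h1.eventually_lt_const hρ)
  set M := max (max x₁ x₂) 0 with hM
  have hM0 : 0 ≤ M := le_max_right _ _
  have hMx₁ : x₁ ≤ M := (le_max_left _ _).trans (le_max_left _ _)
  have hMx₂ : x₂ ≤ M := (le_max_right _ _).trans (le_max_left _ _)
  set W : ℕ → Ω → ℝ := fun t ω => min (1 + X t ω)⁻¹ (1 + M)⁻¹ with hW
  have hWm : StronglyAdapted F W := fun t =>
    Measurable.stronglyMeasurable (((h.adapted t).const_add 1).inv.min measurable_const)
  have hfm : ∀ t, StronglyMeasurable[F t] fun ω => (1 + X t ω)⁻¹ := fun t =>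
    Measurable.stronglyMeasurable ((h.adapted t).const_add 1).inv
  have hpm : ∀ t (e : ℝ), StronglyMeasurable[F t] fun ω => (1 + X t ω) ^ e := fun t e =>
    Measurable.stronglyMeasurable (((h.adapted t).const_add 1).pow_const e)
  have hfi : ∀ t, Integrable (fun ω => (1 + X t ω)⁻¹) P := fun t => by
    refine (integrable_const (1 : ℝ)).mono' ((hfm t).mono (F.le t)).aestronglyMeasurable
      (ae_of_all _ fun ω => ?_)
    have := h.nonneg t ω
    rw [Real.norm_of_nonneg (by positivity)]
    exact inv_le_one_of_one_le₀ (by linarith)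
  have hpb : ∀ t (e : ℝ), 0 ≤ e → ∀ ω, ‖(1 + X t ω) ^ (-e)‖ ≤ 1 := fun t e he ω => by
    have := h.nonneg t ω
    rw [Real.norm_of_nonneg (by positivity)]
    exact Real.rpow_le_one_of_one_le_of_nonpos (by linarith) (by linarith)
  have hpi : ∀ t (e : ℝ), 0 ≤ e → ∀ {f : Ω → ℝ}, Integrable f P →
      Integrable (fun ω => (1 + X t ω) ^ (-e) * f ω) P := fun t e he f hf =>
    hf.bdd_mul ((hpm t _).mono (F.le t)).aestronglyMeasurable (ae_of_all _ (hpb t e he))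
  have hWb : ∀ t ω, |W t ω| ≤ 1 := fun t ω => by
    have := h.nonneg t ω
    rw [abs_of_nonneg (by simp only [hW]; positivity)]
    exact (min_le_left _ _).trans (inv_le_one_of_one_le₀ (by linarith))
  have hWi : ∀ t, Integrable (W t) P := fun t =>
    (integrable_const (1 : ℝ)).mono' ((hWm t).mono (F.le t)).aestronglyMeasurable
      (ae_of_all _ (hWb t))
  have hsuper : Supermartingale W F P := by
    refine supermartingale_nat hWm hWi fun t => ?_
    have hq0 : 0 ≤ q := by linarith
    have h1 := condExp_le_of_le_affine (P := P) (F.le t)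
      (U := fun ω => (1 + X (t + 1) ω)⁻¹) (Δ := fun ω => X (t + 1) ω - X t ω)
      (V := fun ω => |X (t + 1) ω - X t ω| ^ γ)
      (a := fun ω => (1 + X t ω)⁻¹ + C * (1 + X t ω) ^ (-q))
      (b := fun ω => -(1 + X t ω) ^ (-2 : ℝ)) (c := fun ω => C * (1 + X t ω) ^ (-q))
      ((hfm t).add ((hpm t _).const_mul _)) (hpm t _).neg ((hpm t _).const_mul _)
      (hfi (t + 1))
      ((hfi t).add (by simpa using (hpi t q hq0 (integrable_const (1 : ℝ))).const_mul C))
      (h.integrable_increment t) (h.moment.1 t)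
      (by simpa using (hpi t 2 zero_le_two (h.integrable_increment t)).neg)
      (by simpa [mul_assoc] using (hpi t q hq0 (h.moment.1 t)).const_mul C)
      (fun ω => inv_one_add_le h.two_le (min_le_left _ _) (min_le_right _ _)
        (h.nonneg t ω) (h.nonneg (t + 1) ω))
    have h2 : P[W (t + 1) | F t] ≤ᵐ[P] P[fun ω => (1 + X (t + 1) ω)⁻¹ | F t] :=
      condExp_mono (hWi _) (hfi _) (ae_of_all _ fun ω => min_le_left _ _)
    have h3 : P[W (t + 1) | F t] ≤ᵐ[P] P[fun _ => (1 + M)⁻¹ | F t] :=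
      condExp_mono (hWi _) (integrable_const _) (ae_of_all _ fun ω => min_le_right _ _)
    rw [condExp_const (F.le t)] at h3
    filter_upwards [h1, h2, h3, hdrift, h.moment.2] with ω h1 h2 h3 hd hB
    have hx0 := h.nonneg t ω
    have hBt := hB t
    refine le_min ?_ h3
    -- At or below `M` the cap `(1 + M)⁻¹` already suffices; the drift is needed only above.
    rcases le_total (X t ω) M with hc | hc
    · refine h3.trans ?_
      gcongr
    · refine h2.trans (h1.trans ?_)
      have hd := hd t (hMx₁.trans hc)
      change _ + _ * meanDrift P F X t ω + _ ≤ _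
      have ha : 0 < 1 + X t ω := by positivity
      have hxb : X t ω ^ β ≤ (1 + X t ω) ^ β := Real.rpow_le_rpow hx0 (by linarith) hβ
      have hD : 0 ≤ meanDrift P F X t ω := by
        by_contra! hneg
        have := mul_nonpos_of_nonneg_of_nonpos (Real.rpow_nonneg hx0 β) hneg.le
        linarith
      have hd' : ρ ≤ (1 + X t ω) ^ β * meanDrift P F X t ω :=
        hd.trans (mul_le_mul_of_nonneg_right hxb hD)
      have hx := hx₂ (1 + X t ω) (by linarith)
      have e1 : (1 + X t ω) ^ (-q)
          = (1 + X t ω) ^ (-2 - β) * (1 + X t ω) ^ (-(q - (2 + β))) := by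
        rw [← Real.rpow_add ha]; congr 1; ring
      have e2 : (1 + X t ω) ^ (-2 : ℝ) = (1 + X t ω) ^ (-2 - β) * (1 + X t ω) ^ β := by
        rw [← Real.rpow_add ha]; congr 1; ring
      have hp : 0 < (1 + X t ω) ^ (-2 - β) := by positivity
      have hqn : 0 < (1 + X t ω) ^ (-q) := by positivity
      have h5 : C * (1 + X t ω) ^ (-q) * (P[fun ω' => |X (t + 1) ω' - X t ω'| ^ γ | F t]) ω
          ≤ C * (1 + X t ω) ^ (-q) * B := by gcongr
      have h6 : C * (1 + B) * (1 + X t ω) ^ (-q)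
          ≤ (1 + X t ω) ^ (-2 : ℝ) * meanDrift P F X t ω := by
        rw [e1, e2]
        have := mul_le_mul_of_nonneg_left (hx.le.trans hd') hp.le
        nlinarith [this]
      nlinarith [h5, h6]
  have hconv : ∀ᵐ ω ∂P, ∃ c, Tendsto (fun t => W t ω) atTop (𝓝 c) := by
    have h1 := hsuper.neg.exists_ae_tendsto_of_bdd (R := 1) fun t => by
      rw [Pi.neg_apply, eLpNorm_neg, eLpNorm_one_eq_lintegral_enorm,
        ← ofReal_integral_norm_eq_lintegral_enorm (hWi t)]
      refine ENNReal.ofReal_le_of_le_toReal ?_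
      calc ∫ ω, ‖W t ω‖ ∂P ≤ ∫ _, (1 : ℝ) ∂P :=
            integral_mono (hWi t).norm (integrable_const _) (hWb t)
        _ = _ := by simp
    filter_upwards [h1] with ω ⟨c, hc⟩
    exact ⟨-c, by simpa using hc.neg⟩
  filter_upwards [hconv, hX_limsup] with ω ⟨c, hc⟩ hlim
  have hc0 : c ≤ 0 := by
    -- `X` exceeds every `K` infinitely often, and `W` is at most `(1 + K)⁻¹` at those times.
    have hcK : ∀ K : ℕ, c ≤ (1 + (K : ℝ))⁻¹ := fun K => by
      have hfreq : ∃ᶠ t in atTop, ((K : ℝ) : EReal) < X t ω :=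
        frequently_lt_of_lt_limsup (by isBoundedDefault) (by rw [hlim]; exact EReal.coe_lt_top _)
      refine le_of_tendsto_of_frequently hc (hfreq.mono fun t ht => ?_)
      have : (K : ℝ) < X t ω := by exact_mod_cast ht
      refine (min_le_left _ _).trans ?_
      gcongr
    have h0 : Tendsto (fun K : ℕ => (1 + (K : ℝ))⁻¹) atTop (𝓝 0) := by
      simpa [add_comm] using tendsto_one_div_add_atTop_nhds_zero_nat (𝕜 := ℝ)
    exact ge_of_tendsto' h0 hcK
  refine Filter.tendsto_atTop.2 fun K => ?_
  have hK : 0 < (1 + max K M)⁻¹ := by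
    have : 0 ≤ max K M := hM0.trans (le_max_right _ _)
    positivity
  filter_upwards [hc.eventually_lt_const (hc0.trans_lt hK)] with t ht
  have hx0 := h.nonneg t ω
  have hKM : 0 ≤ max K M := hM0.trans (le_max_right _ _)
  -- The cap `(1 + M)⁻¹` cannot be below `(1 + max K M)⁻¹`, so the smallness comes from `X`.
  rcases min_lt_iff.1 ht with h1 | h1
  · rw [inv_lt_inv₀ (by positivity) (by positivity)] at h1
    linarith [le_max_left K M]
  · rw [inv_lt_inv₀ (by positivity) (by positivity)] at h1
    linarith [le_max_right K M]

end IsLampertiProcess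

/-! ### Drift, moments and strong law for `X ^ (1 + β)`. -/

/-- The conditional mean increment of the process `X ^ (1 + β)`. -/
noncomputable def powerDrift {Ω : Type*} [m0 : MeasurableSpace Ω] (P : Measure Ω)
    (F : Filtration ℕ m0) (X : ℕ → Ω → ℝ) (β : ℝ) (t : ℕ) : Ω → ℝ :=
  P[fun ω => X (t + 1) ω ^ (1 + β) - X t ω ^ (1 + β) | F t]

namespace IsLampertiProcess

variable {Ω : Type*} [m0 : MeasurableSpace Ω] {P : Measure Ω} [IsProbabilityMeasure P]
  {F : Filtration ℕ m0} {X : ℕ → Ω → ℝ} {γ B β : ℝ}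

lemma integrable_power_increment (h : IsLampertiProcess P F X γ B) (hβ : 0 ≤ β) (hγ : 1 + β ≤ γ)
    (t : ℕ) : Integrable (fun ω => X (t + 1) ω ^ (1 + β) - X t ω ^ (1 + β)) P :=
  (h.integrable_rpow_le (t + 1) (by positivity) hγ).sub
    (h.integrable_rpow_le t (by positivity) hγ)

lemma powerDrift_ge (h : IsLampertiProcess P F X γ B) (hβ : 0 ≤ β) (hγ : 1 + β ≤ γ) :
    ∀ᵐ ω ∂P, ∀ t, (1 + β) * (X t ω ^ β * meanDrift P F X t ω) ≤ powerDrift P F X β t ω := by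
  refine ae_all_iff.2 fun t => ?_
  have hYi := h.integrable_power_increment hβ hγ t
  have hXD : Integrable (fun ω => (1 + β) * X t ω ^ β * (X (t + 1) ω - X t ω)) P := by
    simpa [mul_assoc] using (h.integrable_rpow_mul_drift t hβ (by linarith)).const_mul (1 + β)
  have h1 := condExp_mono (m := F t) hXD hYi (ae_of_all _ fun ω =>
    rpow_one_add_sub_ge hβ (h.nonneg t ω) (h.nonneg (t + 1) ω))
  have h2 := condExp_mul_of_stronglyMeasurable_left
    ((h.stronglyMeasurable_rpow t β).const_mul (1 + β)) hXD (h.integrable_increment t)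
  filter_upwards [h1, h2] with ω h1 h2
  rw [← mul_assoc]
  exact h2.symm.le.trans h1

/-- Conditional form of `rpow_one_add_sub_le`; the factor `X t` is `F t`-measurable and comes out of
the conditional expectation. -/
lemma mul_powerDrift_le (h : IsLampertiProcess P F X γ B) (hβ : 0 ≤ β) (hβ' : β ≤ 1)
    (hγ : 2 + β ≤ γ) : ∀ᵐ ω ∂P, ∀ t, X t ω * powerDrift P F X β t ω ≤
      (1 + β) * X t ω ^ (1 + β) * meanDrift P F X t ω + β * X t ω ^ β * (1 + B) := by
  refine ae_all_iff.2 fun t => ?_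
  have hYi := h.integrable_power_increment hβ (by linarith) t
  have hXY : Integrable (fun ω => X t ω * (X (t + 1) ω ^ (1 + β) - X t ω ^ (1 + β))) P := by
    have h1 := h.integrable_mul_succ t zero_le_one (by positivity : 0 ≤ 1 + β) (by linarith)
    have h2 := h.integrable_rpow_le t (by positivity : 0 ≤ 1 + (1 + β)) (by linarith)
    refine (h1.sub h2).congr (ae_of_all _ fun ω => ?_)
    have := h.nonneg t ω
    simp only [Pi.sub_apply]
    rw [Real.rpow_add' this (by positivity : 1 + (1 + β) ≠ 0), Real.rpow_one]
    ring
  have h1 := condExp_le_of_le_affine (P := P) (F.le t)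
    (U := fun ω => X t ω * (X (t + 1) ω ^ (1 + β) - X t ω ^ (1 + β)))
    (Δ := fun ω => X (t + 1) ω - X t ω) (V := fun ω => (X (t + 1) ω - X t ω) ^ 2)
    (a := 0) (b := fun ω => (1 + β) * X t ω ^ (1 + β)) (c := fun ω => β * X t ω ^ β)
    stronglyMeasurable_zero ((h.stronglyMeasurable_rpow t _).const_mul _)
    ((h.stronglyMeasurable_rpow t _).const_mul _) hXY (integrable_zero _ _ _)
    (h.integrable_increment t) (h.integrable_sq t)
    (by simpa [mul_assoc] using
      (h.integrable_rpow_mul_drift t (by positivity : 0 ≤ 1 + β) (by linarith)).const_mul (1 + β))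
    (by simpa [mul_assoc] using
      (h.integrable_rpow_mul_sq t hβ (by linarith)).const_mul β)
    (fun ω => by
      simpa using rpow_one_add_sub_le hβ hβ' (h.nonneg t ω) (h.nonneg (t + 1) ω))
  have h2 := condExp_mul_of_stronglyMeasurable_left (h.stronglyMeasurable t) hXY hYi
  filter_upwards [h1, h2, h.condExp_sq_le] with ω h1 h2 h3
  have h4 : β * X t ω ^ β * (P[fun ω' => (X (t + 1) ω' - X t ω') ^ 2 | F t]) ω
      ≤ β * X t ω ^ β * (1 + B) := by
    have := Real.rpow_nonneg (h.nonneg t ω) β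
    exact mul_le_mul_of_nonneg_left (h3 t) (by positivity)
  simp only [Pi.zero_apply, zero_add] at h1
  have h5 := h2.symm.le.trans h1
  change X t ω * powerDrift P F X β t ω ≤
    _ * meanDrift P F X t ω + _ at h5
  linarith

lemma powerDrift_le_of_pos (h : IsLampertiProcess P F X γ B) (hβ : 0 ≤ β) (hβ' : β ≤ 1)
    (hγ : 2 + β ≤ γ) : ∀ᵐ ω ∂P, ∀ t, 0 < X t ω → powerDrift P F X β t ω ≤
      (1 + β) * (X t ω ^ β * meanDrift P F X t ω) + β * (1 + B) * X t ω ^ (-(1 - β)) := by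
  filter_upwards [h.mul_powerDrift_le hβ hβ' hγ] with ω hω t hx
  have h1 := hω t
  have e1 : X t ω ^ (1 + β) = X t ω * X t ω ^ β := by rw [Real.rpow_add hx, Real.rpow_one]
  have e2 : X t ω ^ β = X t ω * X t ω ^ (-(1 - β)) := by
    nth_rw 2 [← Real.rpow_one (X t ω)]
    rw [← Real.rpow_add hx]
    congr 1
    ring
  have e3 : β * X t ω ^ β * (1 + B) = X t ω * (β * (1 + B) * X t ω ^ (-(1 - β))) := by
    rw [e2]; ring
  rw [e1] at h1
  refine le_of_mul_le_mul_left ?_ hx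
  linarith

/-- A crude bound that does not use the drift of `X`, needed where `X` is small and no drift
hypothesis applies. -/
lemma powerDrift_le (h : IsLampertiProcess P F X γ B) (hβ : 0 ≤ β) (hβ' : β ≤ 1)
    (hγ : 2 + β ≤ γ) : ∀ᵐ ω ∂P, ∀ t, powerDrift P F X β t ω ≤
      (2 * X t ω ^ β + 2) * (2 + B) := by
  refine ae_all_iff.2 fun t => ?_
  have hm : StronglyMeasurable[F t] fun ω => 2 * X t ω ^ β + 2 :=
    ((h.stronglyMeasurable_rpow t β).const_mul 2).add_const 2
  have hi : Integrable (fun ω => 2 * X t ω ^ β + 2) P :=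
    ((h.integrable_rpow_le t hβ (by linarith)).const_mul 2).add (integrable_const 2)
  have h1 := condExp_le_of_le_affine (P := P) (F.le t)
    (U := fun ω => X (t + 1) ω ^ (1 + β) - X t ω ^ (1 + β))
    (Δ := 0) (V := fun ω => (X (t + 1) ω - X t ω) ^ 2)
    (a := fun ω => 2 * X t ω ^ β + 2) (b := 0) (c := fun ω => 2 * X t ω ^ β + 2)
    hm stronglyMeasurable_zero hm (h.integrable_power_increment hβ (by linarith) t) hi
    (integrable_zero _ _ _) (h.integrable_sq t) (by simp)
    (by
      have := ((h.integrable_rpow_mul_sq t hβ (by linarith)).const_mul 2).add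
        ((h.integrable_sq t).const_mul 2)
      refine this.congr (ae_of_all _ fun ω => ?_)
      simp only [Pi.add_apply]
      ring)
    (fun ω => by
      have h1 := (le_abs_self _).trans
        (abs_rpow_one_add_sub_le hβ hβ' (h.nonneg t ω) (h.nonneg (t + 1) ω))
      have h2 := rpow_le_one_add_rpow (abs_nonneg (X (t + 1) ω - X t ω)) zero_le_one one_le_two
      have h3 := rpow_le_one_add_rpow (abs_nonneg (X (t + 1) ω - X t ω))
        (by positivity : 0 ≤ 1 + β) (by linarith : 1 + β ≤ 2)
      rw [Real.rpow_two, sq_abs] at h2 h3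
      rw [Real.rpow_one] at h2
      have hx := Real.rpow_nonneg (h.nonneg t ω) β
      have := mul_le_mul_of_nonneg_left h2 (by positivity : 0 ≤ 2 * X t ω ^ β)
      simp only [Pi.zero_apply]
      linarith)
  filter_upwards [h1, h.condExp_sq_le] with ω h1 h2
  have hx := Real.rpow_nonneg (h.nonneg t ω) β
  have h3 := mul_le_mul_of_nonneg_left (h2 t) (by positivity : 0 ≤ 2 * X t ω ^ β + 2)
  simp only [Pi.zero_apply] at h1
  change powerDrift P F X β t ω ≤ _ at h1
  linarith

lemma exists_powerDrift_le (h : IsLampertiProcess P F X γ B) (hβ : 0 ≤ β) (hβ' : β ≤ 1)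
    (hγ : 2 + β ≤ γ) {x₁ r : ℝ} (hx₁ : 1 ≤ x₁)
    (hdrift : ∀ᵐ ω ∂P, ∀ t, x₁ ≤ X t ω → X t ω ^ β * meanDrift P F X t ω ≤ r) :
    ∃ C, 0 ≤ C ∧ ∀ᵐ ω ∂P, ∀ t, powerDrift P F X β t ω ≤ C := by
  have hB := h.bound_nonneg
  refine ⟨max ((1 + β) * r + β * (1 + B)) ((2 * x₁ ^ β + 2) * (2 + B)),
    le_max_of_le_right (by positivity), ?_⟩
  filter_upwards [h.powerDrift_le_of_pos hβ hβ' hγ, h.powerDrift_le hβ hβ' hγ, hdrift]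
    with ω h1 h2 h3 t
  rcases le_total x₁ (X t ω) with hc | hc
  · refine le_max_of_le_left ((h1 t (by linarith)).trans ?_)
    have h4 : X t ω ^ (-(1 - β)) ≤ 1 :=
      Real.rpow_le_one_of_one_le_of_nonpos (hx₁.trans hc) (by linarith)
    have h5 := h3 t hc
    have h6 : β * (1 + B) * X t ω ^ (-(1 - β)) ≤ β * (1 + B) * 1 := by gcongr
    have h7 : (1 + β) * (X t ω ^ β * meanDrift P F X t ω) ≤ (1 + β) * r := by gcongr
    linarith
  · refine le_max_of_le_right ((h2 t).trans ?_)
    have := h.nonneg t ω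
    gcongr

lemma tendsto_powerDrift (h : IsLampertiProcess P F X γ B) (hβ : 0 ≤ β) (hβ' : β < 1)
    (hγ : 2 + β ≤ γ) {ρ : ℝ} (hX : ∀ᵐ ω ∂P, Tendsto (fun t => X t ω) atTop atTop)
    (hdrift : ∀ᵐ ω ∂P, Tendsto (fun t => X t ω ^ β * meanDrift P F X t ω) atTop (𝓝 ρ)) :
    ∀ᵐ ω ∂P, Tendsto (fun t => powerDrift P F X β t ω) atTop (𝓝 ((1 + β) * ρ)) := by
  filter_upwards [hX, hdrift, h.powerDrift_le_of_pos hβ hβ'.le hγ,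
    h.powerDrift_ge hβ (by linarith)] with ω hX hd h1 h2
  have h3 := hd.const_mul (1 + β)
  have h4 := ((tendsto_rpow_neg_atTop (by linarith : 0 < 1 - β)).comp hX).const_mul (β * (1 + B))
  have h5 := h3.add h4
  rw [mul_zero, add_zero] at h5
  refine tendsto_of_tendsto_of_tendsto_of_le_of_le' h3 h5 (Eventually.of_forall h2) ?_
  filter_upwards [hX.eventually_gt_atTop 0] with t ht using h1 t ht

/-- Taking expectations, each step adds at most `C`. -/
lemma exists_integral_rpow_le (h : IsLampertiProcess P F X γ B) (hβ : 0 ≤ β)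
    (hγ : 1 + β ≤ γ) {C : ℝ} (hC : 0 ≤ C) (hdrift : ∀ᵐ ω ∂P, ∀ t, powerDrift P F X β t ω ≤ C) :
    ∃ K, 0 ≤ K ∧ ∀ t : ℕ, ∫ ω, X t ω ^ (1 + β) ∂P ≤ K * (t + 1) := by
  have hi : ∀ t, Integrable (fun ω => X t ω ^ (1 + β)) P := fun t =>
    h.integrable_rpow_le t (by positivity) hγ
  have hstep : ∀ t, ∫ ω, X (t + 1) ω ^ (1 + β) ∂P ≤ ∫ ω, X t ω ^ (1 + β) ∂P + C := fun t => by
    have h1 : ∫ ω, powerDrift P F X β t ω ∂P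
        = ∫ ω, (X (t + 1) ω ^ (1 + β) - X t ω ^ (1 + β)) ∂P := integral_condExp (F.le t)
    rw [integral_sub (hi _) (hi _)] at h1
    have h2 : ∫ ω, powerDrift P F X β t ω ∂P ≤ ∫ _, C ∂P := by
      refine integral_mono_ae integrable_condExp (integrable_const _) ?_
      filter_upwards [hdrift] with ω hω using hω t
    simp only [integral_const, probReal_univ, smul_eq_mul, one_mul] at h2
    linarith
  have h0 : 0 ≤ ∫ ω, X 0 ω ^ (1 + β) ∂P :=
    integral_nonneg fun ω => Real.rpow_nonneg (h.nonneg 0 ω) _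
  refine ⟨∫ ω, X 0 ω ^ (1 + β) ∂P + C, by positivity, fun t => ?_⟩
  induction t with
  | zero => simpa using hC
  | succ t ih =>
    push_cast
    linarith [hstep t]

/-- The squared increment is of order `X ^ (2β) Δ ^ 2 + |Δ| ^ (2 + 2β)`, where `Δ` is the increment
of `X`; the last power is what requires `γ ≥ 2 + 2β`. The first term is controlled by the linear
growth of `E[X ^ (1 + β)]`. -/
lemma exists_integral_power_increment_sq_le (h : IsLampertiProcess P F X γ B) (hβ : 0 ≤ β)
    (hβ' : β < 1) (hγ : 2 + 2 * β ≤ γ) {K : ℝ} (hK : 0 ≤ K)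
    (hint : ∀ t : ℕ, ∫ ω, X t ω ^ (1 + β) ∂P ≤ K * (t + 1)) :
    ∃ L, ∀ t : ℕ, Integrable (fun ω => (X (t + 1) ω ^ (1 + β) - X t ω ^ (1 + β)) ^ 2) P ∧
      ∫ ω, (X (t + 1) ω ^ (1 + β) - X t ω ^ (1 + β)) ^ 2 ∂P
        ≤ L * ((t : ℝ) + 1) ^ (2 * β / (1 + β)) := by
  have hB := h.bound_nonneg
  set θ := 2 * β / (1 + β) with hθ
  have hθ0 : 0 ≤ θ := by positivity
  have hθ1 : θ ≤ 1 := by rw [hθ, div_le_one (by positivity)]; linarith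
  refine ⟨8 * ((1 + B) * (1 + K)) + 8 * (1 + B), fun t => ?_⟩
  have ht1 : (1 : ℝ) ≤ (t : ℝ) + 1 := by linarith [Nat.cast_nonneg (α := ℝ) t]
  have ht0 : (0 : ℝ) < (t : ℝ) + 1 := by positivity
  -- The constant 8 comes from `(2u + 2v) ^ 2 ≤ 8u ^ 2 + 8v ^ 2`.
  have hpt : ∀ ω, (X (t + 1) ω ^ (1 + β) - X t ω ^ (1 + β)) ^ 2 ≤
      8 * (X t ω ^ (2 * β) * (X (t + 1) ω - X t ω) ^ 2)
        + 8 * (1 + |X (t + 1) ω - X t ω| ^ γ) := fun ω => by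
    have h1 := abs_rpow_one_add_sub_le hβ hβ'.le (h.nonneg t ω) (h.nonneg (t + 1) ω)
    have h2 := rpow_le_one_add_rpow (abs_nonneg (X (t + 1) ω - X t ω))
        (by positivity : 0 ≤ 2 + 2 * β) hγ
    set d := |X (t + 1) ω - X t ω| with hd
    have e1 : d ^ (2 + 2 * β) = (d ^ (1 + β)) ^ 2 := by
      rw [← Real.rpow_natCast, ← Real.rpow_mul (abs_nonneg _)]; congr 1; push_cast; ring
    have e2 : X t ω ^ (2 * β) = (X t ω ^ β) ^ 2 := by
      rw [← Real.rpow_natCast, ← Real.rpow_mul (h.nonneg t ω)]; congr 1; push_cast; ring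
    have e3 : (X (t + 1) ω - X t ω) ^ 2 = d ^ 2 := (sq_abs _).symm
    rw [e1] at h2
    rw [e2, e3]
    have h3 := sq_le_sq' (by linarith [neg_abs_le (X (t + 1) ω ^ (1 + β) - X t ω ^ (1 + β))])
      ((le_abs_self _).trans h1)
    nlinarith [sq_nonneg (X t ω ^ β * d - d ^ (1 + β))]
  have hi1 := h.integrable_rpow_mul_sq t (by positivity : 0 ≤ 2 * β) (by linarith)
  have hi2 : Integrable (fun ω => 8 * (1 + |X (t + 1) ω - X t ω| ^ γ)) P :=
    ((integrable_const 1).add (h.moment.1 t)).const_mul 8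
  have hi3 := h.integrable_rpow_le t (by positivity : 0 ≤ 2 * β) (by linarith)
  have hi4 := h.integrable_rpow_le t (by positivity : 0 ≤ 1 + β) (by linarith)
  have hi : Integrable (fun ω => (X (t + 1) ω ^ (1 + β) - X t ω ^ (1 + β)) ^ 2) P := by
    refine ((hi1.const_mul 8).add hi2).mono' ((((h.measurable (t + 1)).pow_const _).sub
      ((h.measurable t).pow_const _)).pow_const 2).aestronglyMeasurable (ae_of_all _ fun ω => ?_)
    rw [Real.norm_of_nonneg (sq_nonneg _)]
    exact hpt ω
  refine ⟨hi, ?_⟩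
  have hV : ∫ ω, |X (t + 1) ω - X t ω| ^ γ ∂P ≤ B := by
    rw [← integral_condExp (F.le t)]
    calc _ ≤ ∫ _, B ∂P := integral_mono_ae integrable_condExp (integrable_const _) (by
          filter_upwards [h.moment.2] with ω hω using hω t)
      _ = B := by simp
  have hmom : ∫ ω, X t ω ^ (2 * β) ∂P ≤ (1 + K) * ((t : ℝ) + 1) ^ θ := by
    -- `X ^ (2β)` is the power `θ ≤ 1` of `X ^ (1 + β)`; after rescaling by `t + 1`, `a ^ θ ≤ 1 + a`
    -- plays the role of Jensen's inequality.
    have hp : ∀ ω, X t ω ^ (2 * β) ≤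
        ((t : ℝ) + 1) ^ θ * (1 + ((t : ℝ) + 1)⁻¹ * X t ω ^ (1 + β)) := fun ω => by
      have hy := Real.rpow_nonneg (h.nonneg t ω) (1 + β)
      have h1 := rpow_le_one_add_rpow (a := ((t : ℝ) + 1)⁻¹ * X t ω ^ (1 + β))
        (by positivity) hθ0 hθ1
      have e : X t ω ^ (2 * β)
          = ((t : ℝ) + 1) ^ θ * (((t : ℝ) + 1)⁻¹ * X t ω ^ (1 + β)) ^ θ := by
        rw [← Real.mul_rpow ht0.le (by positivity), mul_inv_cancel_left₀ ht0.ne',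
          ← Real.rpow_mul (h.nonneg t ω)]
        congr 1
        rw [hθ]
        field_simp
      rw [e]
      rw [Real.rpow_one] at h1
      gcongr
    calc ∫ ω, X t ω ^ (2 * β) ∂P
        ≤ ∫ ω, ((t : ℝ) + 1) ^ θ * (1 + ((t : ℝ) + 1)⁻¹ * X t ω ^ (1 + β)) ∂P :=
          integral_mono hi3 (((integrable_const 1).add (hi4.const_mul _)).const_mul _) hp
      _ = ((t : ℝ) + 1) ^ θ * (1 + ((t : ℝ) + 1)⁻¹ * ∫ ω, X t ω ^ (1 + β) ∂P) := by
          rw [integral_const_mul, integral_add (integrable_const _) (hi4.const_mul _),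
            integral_const_mul]
          simp
      _ ≤ ((t : ℝ) + 1) ^ θ * (1 + ((t : ℝ) + 1)⁻¹ * (K * ((t : ℝ) + 1))) := by
          gcongr; exact hint t
      _ = (1 + K) * ((t : ℝ) + 1) ^ θ := by field_simp
  have hcross : ∫ ω, X t ω ^ (2 * β) * (X (t + 1) ω - X t ω) ^ 2 ∂P
      ≤ (1 + B) * ∫ ω, X t ω ^ (2 * β) ∂P := by
    have h1 := condExp_mul_of_stronglyMeasurable_left (h.stronglyMeasurable_rpow t (2 * β)) hi1
      (h.integrable_sq t)
    rw [← integral_condExp (F.le t), ← integral_const_mul]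
    refine integral_mono_ae integrable_condExp (hi3.const_mul _) ?_
    filter_upwards [h1, h.condExp_sq_le] with ω h1 h2
    refine h1.le.trans ?_
    rw [Pi.mul_apply, mul_comm]
    exact mul_le_mul_of_nonneg_right (h2 t) (Real.rpow_nonneg (h.nonneg t ω) _)
  have hone : (1 : ℝ) ≤ ((t : ℝ) + 1) ^ θ := Real.one_le_rpow ht1 hθ0
  calc ∫ ω, (X (t + 1) ω ^ (1 + β) - X t ω ^ (1 + β)) ^ 2 ∂P
      ≤ ∫ ω, (8 * (X t ω ^ (2 * β) * (X (t + 1) ω - X t ω) ^ 2)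
        + 8 * (1 + |X (t + 1) ω - X t ω| ^ γ)) ∂P :=
        integral_mono hi ((hi1.const_mul 8).add hi2) hpt
    _ = 8 * ∫ ω, X t ω ^ (2 * β) * (X (t + 1) ω - X t ω) ^ 2 ∂P
        + 8 * (1 + ∫ ω, |X (t + 1) ω - X t ω| ^ γ ∂P) := by
        rw [integral_add (hi1.const_mul 8) hi2, integral_const_mul, integral_const_mul,
          integral_add (integrable_const _) (h.moment.1 t)]
        simp
    _ ≤ 8 * ((1 + B) * ((1 + K) * ((t : ℝ) + 1) ^ θ)) + 8 * (1 + B) := by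
        have := mul_le_mul_of_nonneg_left hmom (by positivity : 0 ≤ 1 + B)
        linarith
    _ ≤ _ := by nlinarith

lemma tendsto_rpow_div (h : IsLampertiProcess P F X γ B) (hβ : 0 ≤ β) (hβ' : β < 1)
    (hγ : 2 + 2 * β ≤ γ) {C r : ℝ} (hC : 0 ≤ C)
    (hbound : ∀ᵐ ω ∂P, ∀ t, powerDrift P F X β t ω ≤ C)
    (hlim : ∀ᵐ ω ∂P, Tendsto (fun t => powerDrift P F X β t ω) atTop (𝓝 r)) :
    ∀ᵐ ω ∂P, Tendsto (fun t : ℕ => (t : ℝ)⁻¹ * X t ω ^ (1 + β)) atTop (𝓝 r) := by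
  obtain ⟨K, hK, hint⟩ := h.exists_integral_rpow_le hβ (by linarith) hC hbound
  obtain ⟨L, hL⟩ := h.exists_integral_power_increment_sq_le hβ hβ' hγ hK hint
  have hZm : ∀ t, StronglyMeasurable[F (t + 1)]
      fun ω => X (t + 1) ω ^ (1 + β) - X t ω ^ (1 + β) := fun t =>
    (h.stronglyMeasurable_rpow (t + 1) _).sub
      ((h.stronglyMeasurable_rpow t _).mono (F.mono (Nat.le_succ t)))
  have hZ : ∀ t, MemLp (fun ω => X (t + 1) ω ^ (1 + β) - X t ω ^ (1 + β)) 2 P := fun t =>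
    (memLp_two_iff_integrable_sq ((hZm t).mono (F.le _)).aestronglyMeasurable).2 (hL t).1
  have hsum : Summable fun t : ℕ =>
      (∫ ω, (X (t + 1) ω ^ (1 + β) - X t ω ^ (1 + β)) ^ 2 ∂P) / ((t : ℝ) + 1) ^ 2 := by
    -- Summability of the normalised variances is exactly `β < 1`.
    have hexp : 2 * β / (1 + β) - 2 < -1 := by
      have : 2 * β / (1 + β) < 1 := by rw [div_lt_one (by positivity)]; linarith
      linarith
    have hs := ((summable_nat_add_iff 1).2 (Real.summable_nat_rpow.2 hexp)).mul_left L
    refine hs.of_nonneg_of_le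
      (fun t => div_nonneg (integral_nonneg fun ω => sq_nonneg _) (by positivity)) fun t => ?_
    have ht : (0 : ℝ) < (t : ℝ) + 1 := by positivity
    push_cast
    rw [Real.rpow_sub ht, Real.rpow_two, ← mul_div_assoc]
    exact div_le_div_of_nonneg_right (hL t).2 (by positivity)
  -- The average of the increments telescopes: martingale part, Cesàro mean of the drifts, and the
  -- vanishing initial term.
  filter_upwards [ae_tendsto_average_sub_condExp hZm hZ hsum, hlim] with ω h1 h2
  have h3 := (h1.add h2.cesaro).add
    ((tendsto_inv_atTop_zero.comp tendsto_natCast_atTop_atTop).mul_const (X 0 ω ^ (1 + β)))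
  rw [zero_mul, zero_add, add_zero] at h3
  refine h3.congr fun t => ?_
  have e := Finset.sum_range_sub (fun s => X s ω ^ (1 + β)) t
  rw [Finset.sum_sub_distrib, e]
  change _ * (_ - ∑ s ∈ Finset.range t, powerDrift P F X β s ω) + _ + (t : ℝ)⁻¹ * _ = _
  ring

end IsLampertiProcess

/-! ### The strong law. -/

theorem theorem2p4 {Ω : Type*} [m0 : MeasurableSpace Ω] (P : Measure Ω) [IsProbabilityMeasure P]
    (F : Filtration ℕ m0)
    -- the unbounded state space `S ⊆ [0, ∞)` and the adapted `S`-valued process `X`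
    (S : Set ℝ) (hS_nonneg : S ⊆ Set.Ici 0) (hS_unbdd : ¬ BddAbove S)
    (X : ℕ → Ω → ℝ) (hX_adapted : Adapted F X) (hX_mem : ∀ t ω, X t ω ∈ S)
    -- `P[X_0 ≤ x_0 | F_0] = 1` for some `x_0 ∈ S`
    (hX_init : ∃ x₀ ∈ S, P⟦{ω | X 0 ω ≤ x₀} | F 0⟧ =ᵐ[P] fun _ => (1 : ℝ))
    -- `limsup X_t = ∞` a.s.
    (hX_limsup : ∀ᵐ ω ∂P, limsup (fun t => (X t ω : EReal)) atTop = ⊤)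
    (β : ℝ) (hβ : 0 ≤ β) (hβ' : β < 1)
    (γ B : ℝ) (hγ : 2 + 2 * β < γ) (hmom : IncrementMomentBound P F X γ B)
    (κ : ℕ → Kernel ℝ ℝ) (hκ : IsDriftLaw P F X κ)
    (ρ : ℝ) (hρ : 0 < ρ)
    -- limits as `x → ∞` through `S`
    (hupper : Tendsto (fun x : ℝ => ((x ^ β : ℝ) : EReal) * upperDrift κ x)
      (atTop ⊓ 𝓟 S) (𝓝 (ρ : EReal)))
    (hlower : Tendsto (fun x : ℝ => ((x ^ β : ℝ) : EReal) * lowerDrift κ x)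
      (atTop ⊓ 𝓟 S) (𝓝 (ρ : EReal))) :
    ∀ᵐ ω ∂P, Tendsto (fun t : ℕ => X t ω / (t : ℝ) ^ (1 / (1 + β))) atTop
      (𝓝 (lambdaConst ρ β)) := by
  have hinit : ∃ x₀, ∀ᵐ ω ∂P, X 0 ω ≤ x₀ := by
    obtain ⟨x₀, -, hx₀⟩ := hX_init
    refine ⟨x₀, ?_⟩
    have hs : MeasurableSet[F 0] {ω | X 0 ω ≤ x₀} := hX_adapted 0 measurableSet_Iic
    -- The event is in `F 0`, so its conditional probability is its indicator, which equals one only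
    -- on the event.
    have h1 := condExp_of_stronglyMeasurable (μ := P) (F.le 0)
      (stronglyMeasurable_const.indicator hs : StronglyMeasurable[F 0]
        ({ω | X 0 ω ≤ x₀}.indicator fun _ => (1 : ℝ)))
      ((integrable_const 1).indicator (F.le 0 _ hs))
    rw [h1] at hx₀
    filter_upwards [hx₀] with ω hω
    by_contra hne
    rw [Set.indicator_of_notMem (by simpa using hne)] at hω
    exact zero_ne_one hω
  have h : IsLampertiProcess P F X γ B :=
    ⟨hX_adapted, fun t ω => hS_nonneg (hX_mem t ω), hinit, by linarith, hmom⟩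
  have hdrift := fun {ε : ℝ} (hε : 0 < ε) =>
    eventually_rpow_mul_drift_mem_Icc hX_mem hκ hupper hlower hε
  have hX : ∀ᵐ ω ∂P, Tendsto (fun t => X t ω) atTop atTop := by
    obtain ⟨x₁, -, hx₁⟩ := hdrift (half_pos hρ)
    refine h.tendsto_atTop hX_limsup hβ hβ' (by linarith) (half_pos hρ) (x₁ := x₁) ?_
    filter_upwards [hx₁] with ω hω t ht
    linarith [(hω t ht).1]
  have hD : ∀ᵐ ω ∂P, Tendsto (fun t => X t ω ^ β * meanDrift P F X t ω) atTop (𝓝 ρ) := by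
    -- The tolerances `1 / (n + 1)` are countable, so one null set serves them all.
    have hall : ∀ᵐ ω ∂P, ∀ n : ℕ, ∃ x₁, ∀ t, x₁ ≤ X t ω →
        X t ω ^ β * meanDrift P F X t ω ∈ Set.Icc (ρ - 1 / (n + 1)) (ρ + 1 / (n + 1)) := by
      refine ae_all_iff.2 fun n => ?_
      obtain ⟨x₁, -, hx₁⟩ := hdrift (Nat.one_div_pos_of_nat (α := ℝ) (n := n))
      filter_upwards [hx₁] with ω hω using ⟨x₁, hω⟩
    filter_upwards [hX, hall] with ω hX hall
    refine Metric.tendsto_nhds.2 fun ε hε => ?_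
    obtain ⟨n, hn⟩ := exists_nat_one_div_lt hε
    obtain ⟨x₁, hx₁⟩ := hall n
    filter_upwards [hX.eventually_ge_atTop x₁] with t ht
    obtain ⟨h1, h2⟩ := hx₁ t ht
    rw [Real.dist_eq, abs_lt]
    constructor <;> linarith
  obtain ⟨x₁, hx1, hx₁⟩ := hdrift one_pos
  obtain ⟨C, hC, hbound⟩ := h.exists_powerDrift_le hβ hβ'.le (by linarith) hx1 (r := ρ + 1) (by
    filter_upwards [hx₁] with ω hω t ht using (hω t ht).2)
  have hlim := h.tendsto_powerDrift hβ hβ' (by linarith) hX hD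
  filter_upwards [h.tendsto_rpow_div hβ hβ' hγ.le hC hbound hlim] with ω hω
  have h1 := hω.rpow_const (p := 1 / (1 + β)) (Or.inr (by positivity))
  rw [lambdaConst, mul_comm ρ]
  refine h1.congr fun t => ?_
  rw [Real.mul_rpow (by positivity) (Real.rpow_nonneg (h.nonneg t ω) _),
    ← Real.rpow_mul (h.nonneg t ω), mul_one_div_cancel (by positivity), Real.rpow_one,
    Real.inv_rpow (by positivity), ← div_eq_inv_mul]
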